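/- Conventions on games. For families $\mathcal C,\mathcal D$ of sets, $\mathsf G_1(\mathcal C,\mathcal D)$ is the game in which, for each $n\in\omega$, One chooses $C_n\in\mathcal C$ and Two responds with $x_n\in C_n$; Two wins if $\{x_n:n\in\omega\}\in\mathcal D$, and otherwise One wins. Strategies for One are functions $\sigma:(\bigcup\mathcal C)^{<\omega}\to\mathcal C$ (full information) or $\sigma:\omega\to\mathcal C$ (predetermined). Strategies for Two are functions $\tau:\mathcal C^{<\omega}\to\bigcup\mathcal C$ (full information) or $\tau:\mathcal C\times\omega\to\bigcup\mathcal C$ (Markov: the answer in round $n$ is $\tau(C_n,n)$). A strategy for One is winning if One wins every play following it; a strategy for Two is winning if its answers are always legal ($x_n\in C_n$) and Two wins every play following it. We write $\mathrm I\uparrow$, $\mathrm I\uparrow_{\mathrm{pre}}$, $\mathrm{II}\uparrow$, $\mathrm{II}\uparrow_{\mathrm{mark}}$ for the existence of a winning strategy of the corresponding kind. Games $G,H$ are equivalent, $G\equiv H$, if each of the four statements $\mathrm{II}\uparrow_{\mathrm{mark}}$, $\mathrm{II}\uparrow$, $\mathrm I\not\uparrow$, $\mathrm I\not\uparrow_{\mathrm{pre}}$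 holds for $G$ if and only if it holds for $H$. They are dual if $\mathrm I\uparrow G\iff\mathrm{II}\uparrow H$, $\mathrm{II}\uparrow G\iff\mathrm I\uparrow H$, $\mathrm I\uparrow_{\mathrm{pre}}G\iff\mathrm{II}\uparrow_{\mathrm{mark}}H$ and $\mathrm{II}\uparrow_{\mathrm{mark}}G\iff\mathrm I\uparrow_{\mathrm{pre}}H$. Conventions on spaces. An ideal of closed sets of a space $X$ is a family $\mathcal A$ of non-empty closed subsets of $X$ that is closed under unions of two members and under passing to non-empty closed subsets, contains every $\{x\}$ with $x\in X$, and does not contain $X$. The space $X$ is $\mathcal A$-normal if for every $A\in\mathcal A$ and every open $U\supseteq A$ there is an open $V$ with $A\subseteq V\subseteq\mathrm{cl}(V)\subseteq U$. An $\mathcal A$-cover of $X$ is an open cover $\mathscr U$ of $X$ with $\emptyset\notin\mathscr U$ and $X\notin\mathscr U$ such that every $A\in\mathcal A$ is contained in some $U\in\mathscr U$; $\mathcal O_X(\mathcal A)$ is the set of all $\mathcal A$-covers. For a space $Y$ and $y\in Y$: $\mathscr T_Y$ is the set of proper non-empty open subsets of $Y$, $\mathscr N_{Y,y}=\{U\in\mathscr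 T_Y:y\in U\}$, $\mathscr N_Y(A)=\{U\in\mathscr T_Y:A\subseteq U\}$, $\mathscr N_Y[\mathcal A]=\{\mathscr N_Y(A):A\in\mathcal A\}$, $\mathscr D_Y$ is the set of dense subsets of $Y$, and $\Omega_{Y,y}=\{S\subseteq Y:y\in\mathrm{cl}(S)\}$. For a collection $\mathcal D$, $\neg\mathcal D$ is the collection of sets that are not in $\mathcal D$. A cusco map on $X$ is a function $\Phi$ assigning to each $x\in X$ a non-empty compact convex set $\Phi(x)\subseteq\mathbb R$ such that $\{x\in X:\Phi(x)\subseteq V\}$ is open for every open $V\subseteq\mathbb R$; it is minimal if its graph $\{(x,y):y\in\Phi(x)\}$ is minimal under inclusion among the graphs of cusco maps on $X$. $\mathrm{MC}_{\mathcal A}(X)$ is the set $\mathrm{MC}(X)$ of all minimal cusco maps on $X$ with the topology of the uniformity with base $\{\mathbf W(A,\varepsilon):A\in\mathcal A,\ \varepsilon>0\}$, where $(\Phi,\Psi)\in\mathbf W(A,\varepsilon)$ means that, for every $x\in A$, $\Phi(x)\subseteq\bigcup_{y\in\Psi(x)}(y-\varepsilon,y+\varepsilon)$ and $\Psi(x)\subseteq\bigcup_{y\in\Phi(x)}(y-\varepsilon,y+\varepsilon)$.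 Let $\mathbf 0\in\mathrm{MC}(X)$ be the map with constant value $\{0\}$. Statement. Let $X$ be a non-empty Hausdorff space, let $\mathcal A$ and $\mathcal B$ be ideals of closed sets of $X$, and suppose that $X$ is $\mathcal A$-normal. Then $$\mathcal G:=\mathsf G_1(\mathcal O_X(\mathcal A),\mathcal O_X(\mathcal B))\equiv\mathsf G_1(\Omega_{\mathrm{MC}_{\mathcal A}(X),\mathbf 0},\Omega_{\mathrm{MC}_{\mathcal B}(X),\mathbf 0})\equiv\mathsf G_1(\mathscr D_{\mathrm{MC}_{\mathcal A}(X)},\Omega_{\mathrm{MC}_{\mathcal B}(X),\mathbf 0}),$$ $$\mathcal H:=\mathsf G_1(\mathscr N_X[\mathcal A],\neg\mathcal O_X(\mathcal B))\equiv\mathsf G_1(\mathscr N_{\mathrm{MC}_{\mathcal A}(X),\mathbf 0},\neg\Omega_{\mathrm{MC}_{\mathcal B}(X),\mathbf 0})\equiv\mathsf G_1(\mathscr T_{\mathrm{MC}_{\mathcal A}(X)},\neg\Omega_{\mathrm{MC}_{\mathcal B}(X),\mathbf 0}),$$ and $\mathcal G$ is dual to $\mathcal H$. -/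

import Mathlib

open Set Filter Topology Uniformity

/-! ## Single-selection games -/

/-- The data of a single-selection game `G₁(𝒜, ℬ)`: in round `n`, One chooses `Aₙ ∈ 𝒜` and Two
answers with `xₙ ∈ Aₙ`; Two wins if `{xₙ : n ∈ ω} ∈ ℬ`. Here `𝒜 = moves` and `ℬ = target`. -/
structure SelectionGame (M : Type*) where
  moves : Set (Set M)
  target : Set (Set M)

/-- The game `G₁(𝒜, ℬ)`. -/
def G₁ {M : Type*} (𝒜 ℬ : Set (Set M)) : SelectionGame M := ⟨𝒜, ℬ⟩

namespace SelectionGame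

/-- `I ↑ G`: One has a winning full-information strategy `σ : (⋃ 𝒜)^{<ω} → 𝒜`. -/
def OneWins {M : Type*} (G : SelectionGame M) : Prop :=
  ∃ σ : List (⋃₀ G.moves : Set M) → G.moves,
    ∀ x : ℕ → (⋃₀ G.moves : Set M),
      (∀ n, (x n : M) ∈ (σ ((List.range n).map x) : Set M)) →
        range (fun n => (x n : M)) ∉ G.target

/-- `II ↑ G`: Two has a winning full-information strategy `τ : 𝒜^{<ω} → ⋃ 𝒜`, all of whose
answers are legal. -/
def TwoWins {M : Type*} (G : SelectionGame M) : Prop :=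
  ∃ τ : List G.moves → (⋃₀ G.moves : Set M),
    ∀ A : ℕ → G.moves,
      (∀ n, (τ ((List.range (n + 1)).map A) : M) ∈ (A n : Set M)) ∧
        range (fun n => (τ ((List.range (n + 1)).map A) : M)) ∈ G.target

/-- One has a winning predetermined strategy `σ : ω → 𝒜`. -/
def OneWinsPre {M : Type*} (G : SelectionGame M) : Prop :=
  ∃ σ : ℕ → G.moves,
    ∀ x : ℕ → M, (∀ n, x n ∈ (σ n : Set M)) → range x ∉ G.target

/-- Two has a winning Markov strategy `τ : 𝒜 × ω → ⋃ 𝒜`, all of whose answers are legal. -/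
def TwoWinsMark {M : Type*} (G : SelectionGame M) : Prop :=
  ∃ τ : G.moves × ℕ → (⋃₀ G.moves : Set M),
    ∀ A : ℕ → G.moves,
      (∀ n, (τ (A n, n) : M) ∈ (A n : Set M)) ∧
        range (fun n => (τ (A n, n) : M)) ∈ G.target

/-- Equivalence `G ≡ H` of selection games. -/
def Equivalent {M N : Type*} (G : SelectionGame M) (H : SelectionGame N) : Prop :=
  (G.TwoWinsMark ↔ H.TwoWinsMark) ∧ (G.TwoWins ↔ H.TwoWins) ∧
    (¬ G.OneWins ↔ ¬ H.OneWins) ∧ (¬ G.OneWinsPre ↔ ¬ H.OneWinsPre)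

/-- Duality of selection games. -/
def Dual {M N : Type*} (G : SelectionGame M) (H : SelectionGame N) : Prop :=
  (G.OneWins ↔ H.TwoWins) ∧ (G.TwoWins ↔ H.OneWins) ∧
    (G.OneWinsPre ↔ H.TwoWinsMark) ∧ (G.TwoWinsMark ↔ H.OneWinsPre)

end SelectionGame

/-! ## Families attached to a topological space

The topology is an explicit argument where the same set carries several topologies. -/

/-- `𝒯_X`: the proper non-empty open sets. -/
def properOpens {X : Type*} (t : TopologicalSpace X) : Set (Set X) :=
  {U | IsOpen[t] U ∧ U.Nonempty ∧ U ≠ univ}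

/-- `𝒩_{X,x}`: the proper open sets containing `x`. -/
def pointNhds {X : Type*} (t : TopologicalSpace X) (x : X) : Set (Set X) :=
  {U | U ∈ properOpens t ∧ x ∈ U}

/-- `𝒩_X(A)`: the proper non-empty open sets containing the set `A`. -/
def setNhds {X : Type*} (t : TopologicalSpace X) (A : Set X) : Set (Set X) :=
  {U | U ∈ properOpens t ∧ A ⊆ U}

/-- `𝒩_X[𝒜] = {𝒩_X(A) : A ∈ 𝒜}`. -/
def setNhdsFamily {X : Type*} (t : TopologicalSpace X) (𝒜 : Set (Set X)) : Set (Set (Set X)) :=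
  setNhds t '' 𝒜

/-- `𝒟_X`: the dense subsets. -/
def denseSets {X : Type*} (t : TopologicalSpace X) : Set (Set X) :=
  {D | @Dense X t D}

/-- `Ω_{X,x}`: the sets having `x` in their closure. -/
def clusterSets {X : Type*} (t : TopologicalSpace X) (x : X) : Set (Set X) :=
  {S | x ∈ @closure X t S}

/-- `𝒪_X(𝒜)`: the `𝒜`-covers of `X`, that is, the non-trivial open covers `𝒰` such that each
`A ∈ 𝒜` is contained in some `U ∈ 𝒰`. -/
def idealCovers {X : Type*} (t : TopologicalSpace X) (𝒜 : Set (Set X)) : Set (Set (Set X)) :=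
  {𝒰 | (∀ U ∈ 𝒰, IsOpen[t] U) ∧ ⋃₀ 𝒰 = univ ∧ ∅ ∉ 𝒰 ∧ univ ∉ 𝒰 ∧ ∀ A ∈ 𝒜, ∃ U ∈ 𝒰, A ⊆ U}

/-- `𝒜` is an ideal of closed sets of `X`, not containing `X` itself. -/
structure IsIdealOfClosedSets {X : Type*} [TopologicalSpace X] (𝒜 : Set (Set X)) : Prop where
  nonempty : ∀ A ∈ 𝒜, A.Nonempty
  isClosed : ∀ A ∈ 𝒜, IsClosed A
  union : ∀ A ∈ 𝒜, ∀ B ∈ 𝒜, A ∪ B ∈ 𝒜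
  subset : ∀ A ∈ 𝒜, ∀ B ⊆ A, IsClosed B → B.Nonempty → B ∈ 𝒜
  singleton : ∀ x : X, {x} ∈ 𝒜
  proper : univ ∉ 𝒜

/-- `X` is `𝒜`-normal. -/
def IsIdealNormal {X : Type*} [TopologicalSpace X] (𝒜 : Set (Set X)) : Prop :=
  ∀ A ∈ 𝒜, ∀ U : Set X, IsOpen U → A ⊆ U →
    ∃ V : Set X, IsOpen V ∧ A ⊆ V ∧ V ⊆ closure V ∧ closure V ⊆ U

/-! ## Minimal cusco maps -/

/-- The graph of a set-valued map. -/
def setValuedGraph {X Y : Type*} (Φ : X → Set Y) : Set (X × Y) := {p | p.2 ∈ Φ p.1}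

/-- Usco maps: upper semicontinuous set-valued maps with non-empty compact values. -/
structure IsUsco {X Y : Type*} [TopologicalSpace X] [TopologicalSpace Y] (Φ : X → Set Y) :
    Prop where
  upper : UpperHemicontinuous Φ
  nonempty : ∀ x, (Φ x).Nonempty
  isCompact : ∀ x, IsCompact (Φ x)

/-- Upper semicontinuity means that `{x | Φ x ⊆ V}` is open for every open `V`. -/
theorem upperHemicontinuous_iff_isOpen_setOf {X Y : Type*} [TopologicalSpace X]
    [TopologicalSpace Y] {Φ : X → Set Y} :
    UpperHemicontinuous Φ ↔ ∀ V : Set Y, IsOpen V → IsOpen {x | Φ x ⊆ V} := by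
  rw [upperHemicontinuous_iff_forall_isOpen]
  simp only [isOpen_iff_mem_nhds]
  exact ⟨fun h V hV x hx => h x V hV hx, fun h x V hV hx => h V hV x hx⟩

/-- Cusco maps: convex-valued usco maps (here into the real line). -/
structure IsCusco {X : Type*} [TopologicalSpace X] (Φ : X → Set ℝ) : Prop extends IsUsco Φ where
  convex : ∀ x, Convex ℝ (Φ x)

/-- Minimal cusco maps: cusco maps whose graph is minimal, with respect to inclusion, among the
graphs of cusco maps. -/
def IsMinimalCusco {X : Type*} [TopologicalSpace X] (Φ : X → Set ℝ) : Prop :=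
  IsCusco Φ ∧ ∀ Ψ : X → Set ℝ, IsCusco Ψ →
    setValuedGraph Ψ ⊆ setValuedGraph Φ → setValuedGraph Ψ = setValuedGraph Φ

/-- `MC(X)`: the set of minimal cusco maps from `X` to the real line. -/
def MC (X : Type*) [TopologicalSpace X] : Type _ := {Φ : X → Set ℝ // IsMinimalCusco Φ}

theorem isMinimalCusco_zero {X : Type*} [TopologicalSpace X] :
    IsMinimalCusco (fun _ : X => ({0} : Set ℝ)) := by
  refine ⟨⟨⟨upperHemicontinuous_iff_isOpen_setOf.2 fun V _ => isOpen_const, fun _ => singleton_nonempty _, fun _ => isCompact_singleton⟩,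
    fun _ => convex_singleton _⟩, fun Ψ hΨ h => h.antisymm ?_⟩
  rintro ⟨x, y⟩ hy
  obtain ⟨z, hz⟩ := hΨ.nonempty x
  have hz0 : z = 0 := @h (x, z) hz
  have hy0 : y = 0 := hy
  subst hz0 hy0
  exact hz

/-- `𝟎`: the minimal cusco map that is constantly `{0}`. -/
def MC.zero (X : Type*) [TopologicalSpace X] : MC X := ⟨fun _ => {0}, isMinimalCusco_zero⟩

/-- `W(A, ε)`: the pairs `(Φ, Ψ)` such that, for all `x ∈ A`, `Φ x` lies in the union of the open
`ε`-balls centred at points of `Ψ x`, and vice versa. -/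
def MC.W {X : Type*} [TopologicalSpace X] (A : Set X) (ε : ℝ) : Set (MC X × MC X) :=
  {p | ∀ x ∈ A, p.1.1 x ⊆ Metric.thickening ε (p.2.1 x) ∧
    p.2.1 x ⊆ Metric.thickening ε (p.1.1 x)}

theorem MC.W_subset_comp {X : Type*} [TopologicalSpace X] (A : Set X) (ε : ℝ) :
    SetRel.comp (MC.W A (ε / 2)) (MC.W A (ε / 2)) ⊆ MC.W A ε := by
  rintro ⟨Φ, Ψ⟩ ⟨Θ, h1, h2⟩ x hx
  have key : ∀ S T R : Set ℝ, S ⊆ Metric.thickening (ε / 2) T → T ⊆ Metric.thickening (ε / 2) R →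
      S ⊆ Metric.thickening ε R := fun S T R hST hTR =>
    hST.trans ((Metric.thickening_subset_of_subset _ hTR).trans
      ((Metric.thickening_thickening_subset _ _ _).trans (by rw [add_halves])))
  exact ⟨key _ _ _ (h1 x hx).1 (h2 x hx).1, key _ _ _ (h2 x hx).2 (h1 x hx).2⟩

/-- The uniformity on `MC(X)` generated by the sets `W(A, ε)` with `A ∈ 𝒜` and `ε > 0`. -/
@[reducible] def MC.uniformSpace {X : Type*} [TopologicalSpace X] (𝒜 : Set (Set X)) : UniformSpace (MC X) :=
  UniformSpace.ofCore
    { uniformity := ⨅ A ∈ 𝒜, ⨅ ε : ℝ, ⨅ _ : 0 < ε, 𝓟 (MC.W A ε)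
      refl := by
        simp only [le_iInf_iff, Filter.le_principal_iff, Filter.mem_principal]
        rintro A - ε hε ⟨Φ, Ψ⟩ rfl x -
        exact ⟨Metric.self_subset_thickening hε _, Metric.self_subset_thickening hε _⟩
      symm := by
        simp only [Filter.tendsto_iInf, Filter.tendsto_principal]
        intro A hA ε hε
        have h : MC.W A ε ∈ ⨅ A ∈ 𝒜, ⨅ ε : ℝ, ⨅ _ : 0 < ε, 𝓟 (MC.W (X := X) A ε) :=
          Filter.mem_iInf_of_mem A <| Filter.mem_iInf_of_mem hA <| Filter.mem_iInf_of_mem ε <|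
            Filter.mem_iInf_of_mem hε <| Filter.mem_principal_self _
        filter_upwards [h] with p hp x hx
        exact (hp x hx).symm
      comp := by
        simp only [le_iInf_iff, Filter.le_principal_iff]
        intro A hA ε hε
        have h : MC.W A (ε / 2) ∈ ⨅ A ∈ 𝒜, ⨅ ε : ℝ, ⨅ _ : 0 < ε, 𝓟 (MC.W (X := X) A ε) :=
          Filter.mem_iInf_of_mem A <| Filter.mem_iInf_of_mem hA <|
            Filter.mem_iInf_of_mem (ε / 2) <| Filter.mem_iInf_of_mem (half_pos hε) <|
              Filter.mem_principal_self _
        exact Filter.mem_of_superset (Filter.mem_lift' h) (MC.W_subset_comp A ε) }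

/-- The topology of `MC_𝒜(X)`, that is, of uniform convergence on the members of `𝒜`. -/
@[reducible] def MC.topology {X : Type*} [TopologicalSpace X] (𝒜 : Set (Set X)) : TopologicalSpace (MC X) :=
  (MC.uniformSpace 𝒜).toTopologicalSpace

/-- For an ideal of closed sets, the sets `W(A, ε)` are a base of the uniformity. -/
theorem MC.hasBasis_uniformity {X : Type*} [TopologicalSpace X] [Nonempty X] {𝒜 : Set (Set X)}
    (h𝒜 : IsIdealOfClosedSets 𝒜) :
    (@uniformity (MC X) (MC.uniformSpace 𝒜)).HasBasis
      (fun p : Set X × ℝ => p.1 ∈ 𝒜 ∧ 0 < p.2) (fun p => MC.W p.1 p.2) := by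
  have e : @uniformity (MC X) (MC.uniformSpace 𝒜) =
      ⨅ p ∈ {p : Set X × ℝ | p.1 ∈ 𝒜 ∧ 0 < p.2}, 𝓟 (MC.W p.1 p.2) := by
    change (⨅ A ∈ 𝒜, ⨅ ε : ℝ, ⨅ _ : 0 < ε, 𝓟 (MC.W A ε)) = _
    simp only [mem_ofPred_eq, iInf_prod, iInf_and]
    refine iInf_congr fun A => ?_
    rw [iInf_comm]
  rw [e]
  refine Filter.hasBasis_biInf_principal ?_ ?_
  · rintro ⟨A, ε⟩ ⟨hA, hε⟩ ⟨B, δ⟩ ⟨hB, hδ⟩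
    refine ⟨(A ∪ B, min ε δ), ⟨h𝒜.union A hA B hB, lt_min hε hδ⟩, ?_, ?_⟩
    · intro p hp x hx
      exact ⟨((hp x (Or.inl hx)).1).trans (Metric.thickening_mono (min_le_left _ _) _),
        ((hp x (Or.inl hx)).2).trans (Metric.thickening_mono (min_le_left _ _) _)⟩
    · intro p hp x hx
      exact ⟨((hp x (Or.inr hx)).1).trans (Metric.thickening_mono (min_le_right _ _) _),
        ((hp x (Or.inr hx)).2).trans (Metric.thickening_mono (min_le_right _ _) _)⟩
  · obtain ⟨x⟩ := ‹Nonempty X›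
    exact ⟨({x}, 1), h𝒜.singleton x, one_pos⟩

/-!
The three games in which One plays covers, cluster sets or dense sets are compared in a circle, by
round-by-round translations (`SelectionGame.transfers_of_translation`): a translation turns each
move of One in the second game into a move in the first, and each answer there into an answer to
the original move, and thereby carries all four kinds of strategies across.

* From covers of `X` to cluster sets at `𝟎` (`transfers_idealCovers_clusterSets`): by upper
  semicontinuity the sets `{x | Φ x ⊆ (-ε, ε)}`, for `Φ` in a set clustering at `𝟎`, form an
  `𝒜`-cover unless one of them is the whole space, and then `Φ` is small everywhere. In round `n` a
  bound tending to zero with `n` is used. This suffices because in a sequence enumerating a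
  `ℬ`-cover each `B ∈ ℬ` is contained in infinitely many terms.
* From cluster sets to dense sets there is nothing to do, dense sets being cluster sets.
* From dense sets back to covers (`transfers_denseSets_idealCovers`): the minimal cusco maps that are
  constantly `1` off some member of an `𝒜`-cover are dense. Given `Φ` and `A ∈ 𝒜`, normality
  provides an open `V ⊇ A` whose closure lies in a member of the cover. The map that is `Φ` on `V`,
  `1` off the closure of `V`, and the convex hull of both on the boundary is a cusco map; by Zorn's
  lemma it contains a minimal one, and this agrees with `Φ` on `V` because minimality is local
  (`IsMinimalCusco.exists_eqOn`).

The games in the second chain are dual to those in the first: the neighbourhood families reflect the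
families of covers, cluster sets and dense sets, in the sense that choosing a point from each
neighbourhood produces such a set, and every such set meets every neighbourhood. Duality then holds
for every target (`SelectionGame.Reflects.dual`), and equivalences pass to the dual games.
-/

/-! ### Histories and normal forms of strategies -/

/-- The list of answers produced by the rule `s`, which computes each answer from the earlier
answers and the current input. -/
def answers {Y Z : Type*} (s : List Y → Z → Y) (l : List Z) : List Y :=
  l.foldl (fun h z => h ++ [s h z]) []

theorem answers_map_range {Y Z : Type*} (s : List Y → Z → Y) (z : ℕ → Z) (n : ℕ) :
    answers s ((List.range n).map z) =
      (List.range n).map fun k => s (answers s ((List.range k).map z)) (z k) := by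
  induction n with
  | zero => rfl
  | succ n ih =>
    rw [List.range_succ, List.map_append, List.map_append, ← ih]
    simp [answers]

namespace SelectionGame

variable {M N : Type*}

theorem oneWins_iff {G : SelectionGame M} :
    G.OneWins ↔ ∃ σ : List M → G.moves, ∀ x : ℕ → M,
      (∀ n, x n ∈ (σ ((List.range n).map x) : Set M)) → range x ∉ G.target := by
  classical
  constructor
  · rintro ⟨σ, hσ⟩
    refine ⟨fun l => σ (l.filterMap fun a =>
      if h : a ∈ ⋃₀ G.moves then some ⟨a, h⟩ else none), fun x hx => ?_⟩
    have hmem : ∀ n, x n ∈ ⋃₀ G.moves := fun n => ⟨_, Subtype.coe_prop _, hx n⟩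
    refine hσ (fun n => ⟨x n, hmem n⟩) fun n => ?_
    convert hx n using 3
    rw [List.filterMap_map, ← List.filterMap_eq_map]
    congr 1
    funext k
    simp only [Function.comp_apply, dif_pos (hmem k)]
  · rintro ⟨σ, hσ⟩
    refine ⟨fun l => σ (l.map Subtype.val), fun x hx => hσ (fun n => x n) fun n => ?_⟩
    simpa [Function.comp_def] using hx n

theorem twoWins_iff {G : SelectionGame M} (hG : G.moves.Nonempty) :
    G.TwoWins ↔ ∃ τ : List G.moves → G.moves → M, (∀ l (A : G.moves), τ l A ∈ (A : Set M)) ∧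
      ∀ A : ℕ → G.moves, range (fun n => τ ((List.range n).map A) (A n)) ∈ G.target := by
  classical
  constructor
  · rintro ⟨τ, hτ⟩
    refine ⟨fun l A => τ (l ++ [A]), fun l A => ?_, fun A => ?_⟩
    · -- a finite history is an initial segment of a full sequence of moves
      have h := (hτ fun i => l.getD i A).1 l.length
      have e : (List.range (l.length + 1)).map (fun i => l.getD i A) = l ++ [A] := by
        rw [List.range_succ, List.map_append]
        congr 1
        · refine List.ext_getElem (by simp) fun i h1 h2 => ?_
          simp [h2]
        · simp
      rw [e] at h
      simpa using h
    · simpa [List.range_succ] using (hτ A).2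
  · rintro ⟨τ, hτ, hwin⟩
    obtain ⟨A₀, hA₀⟩ := hG
    have hmem : ∀ l A, τ l A ∈ ⋃₀ G.moves := fun l A => ⟨A, A.2, hτ l A⟩
    refine ⟨fun l => if h : l = [] then ⟨_, hmem [] ⟨A₀, hA₀⟩⟩
      else ⟨_, hmem l.dropLast (l.getLast h)⟩, fun A => ?_⟩
    have e : ∀ n, (((if h : (List.range (n + 1)).map A = [] then ⟨_, hmem [] ⟨A₀, hA₀⟩⟩
        else ⟨_, hmem ((List.range (n + 1)).map A).dropLast
          (((List.range (n + 1)).map A).getLast h)⟩ : (⋃₀ G.moves : Set M))) : M) =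
        τ ((List.range n).map A) (A n) := by
      intro n
      simp [List.range_succ]
    simp only [e]
    exact ⟨fun n => hτ _ _, hwin A⟩

theorem twoWinsMark_iff {G : SelectionGame M} :
    G.TwoWinsMark ↔ ∃ τ : ℕ → G.moves → M, (∀ n (A : G.moves), τ n A ∈ (A : Set M)) ∧
      ∀ A : ℕ → G.moves, range (fun n => τ n (A n)) ∈ G.target := by
  constructor
  · rintro ⟨τ, hτ⟩
    exact ⟨fun n A => τ (A, n), fun n A => (hτ fun _ => A).1 n, fun A => (hτ A).2⟩
  · rintro ⟨τ, hτ, hwin⟩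
    exact ⟨fun p => ⟨τ p.2 p.1, p.1, p.1.2, hτ _ _⟩, fun A => ⟨fun n => hτ _ _, hwin A⟩⟩

/-! ### Transfer of strategies between games -/

/-- `G.Transfers H`: each kind of winning strategy for Two passes from `G` to `H`, and each kind for
One passes from `H` to `G`. -/
structure Transfers (G : SelectionGame M) (H : SelectionGame N) : Prop where
  twoMark : G.TwoWinsMark → H.TwoWinsMark
  two : G.TwoWins → H.TwoWins
  one : H.OneWins → G.OneWins
  onePre : H.OneWinsPre → G.OneWinsPre

theorem Transfers.trans {P : Type*} {G : SelectionGame M} {H : SelectionGame N}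
    {K : SelectionGame P} (h : G.Transfers H) (h' : H.Transfers K) : G.Transfers K :=
  ⟨h'.twoMark ∘ h.twoMark, h'.two ∘ h.two, h.one ∘ h'.one, h.onePre ∘ h'.onePre⟩

theorem Transfers.equivalent {G : SelectionGame M} {H : SelectionGame N}
    (h : G.Transfers H) (h' : H.Transfers G) : G.Equivalent H :=
  ⟨⟨h.twoMark, h'.twoMark⟩, ⟨h.two, h'.two⟩, not_congr ⟨h'.one, h.one⟩,
    not_congr ⟨h'.onePre, h.onePre⟩⟩

/-- Strategies transfer along a round-by-round translation: `I n B` is the move of `G` that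
simulates the move `B` of `H` in round `n`, and `J n B` turns answers to `I n B` into answers
to `B`. -/
theorem transfers_of_translation {G : SelectionGame M} {H : SelectionGame N}
    (hG : G.moves.Nonempty) (hH : H.moves.Nonempty)
    (I : ℕ → H.moves → G.moves) (J : ℕ → H.moves → M → N)
    (legal : ∀ n B, ∀ x ∈ (I n B : Set M), J n B x ∈ (B : Set N))
    (win : ∀ (B : ℕ → H.moves) (x : ℕ → M), (∀ n, x n ∈ (I n (B n) : Set M)) →
      range x ∈ G.target → range (fun n => J n (B n) (x n)) ∈ H.target) :
    G.Transfers H where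
  twoMark h := by
    obtain ⟨τ, hτ, hw⟩ := twoWinsMark_iff.1 h
    exact twoWinsMark_iff.2 ⟨fun n B => J n B (τ n (I n B)), fun n B => legal _ _ _ (hτ _ _),
      fun B => win B _ (fun n => hτ _ _) (hw fun n => I n (B n))⟩
  two h := by
    obtain ⟨τ, hτ, hw⟩ := (twoWins_iff hG).1 h
    refine (twoWins_iff hH).2 ⟨fun l B => J l.length B (τ (l.mapIdx I) (I l.length B)),
      fun l B => legal _ _ _ (hτ _ _), fun B => ?_⟩
    have e : ∀ n, ((List.range n).map B).mapIdx I = (List.range n).map fun k => I k (B k) :=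
      fun n => List.ext_getElem (by simp) fun i h1 h2 => by simp
    simp only [e, List.length_map, List.length_range]
    exact win B (fun n => τ ((List.range n).map fun k => I k (B k)) (I n (B n)))
      (fun n => hτ _ _) (hw fun n => I n (B n))
  one h := by
    obtain ⟨σ, hσ⟩ := oneWins_iff.1 h
    let s : List N → M → N := fun h x => J h.length (σ h) x
    refine oneWins_iff.2 ⟨fun l => I l.length (σ (answers s l)), fun x hx ht => ?_⟩
    let y : ℕ → N := fun n => s (answers s ((List.range n).map x)) (x n)
    have e : ∀ n, answers s ((List.range n).map x) = (List.range n).map y :=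
      answers_map_range s x
    have hy : y = fun n => J n (σ ((List.range n).map y)) (x n) := by
      funext n
      change J (answers s ((List.range n).map x)).length (σ (answers s ((List.range n).map x))) _ = _
      rw [e, List.length_map, List.length_range]
    have hx' : ∀ n, x n ∈ (I n (σ ((List.range n).map y)) : Set M) := fun n => by
      have := hx n
      beta_reduce at this
      rwa [e, List.length_map, List.length_range] at this
    refine hσ y (fun n => ?_) ?_
    · have := legal n _ _ (hx' n)
      rwa [← congrFun hy n] at this
    · rw [hy]
      exact win (fun n => σ ((List.range n).map y)) x hx' ht
  onePre h := by
    obtain ⟨σ, hσ⟩ := h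
    exact ⟨fun n => I n (σ n), fun x hx ht =>
      hσ _ (fun n => legal _ _ _ (hx n)) (win σ x hx ht)⟩

/-- A game with fewer moves for One is easier for Two. -/
theorem transfers_of_moves_subset {𝒜 𝒜' ℬ : Set (Set M)} (h𝒜 : 𝒜'.Nonempty) (h : 𝒜' ⊆ 𝒜) :
    (G₁ 𝒜 ℬ).Transfers (G₁ 𝒜' ℬ) :=
  transfers_of_translation (H := G₁ 𝒜' ℬ) (h𝒜.mono h) h𝒜 (fun _ B => ⟨B, h B.2⟩)
    (fun _ _ x => x) (fun _ _ _ hx => hx) (fun _ _ _ hx => hx)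

/-! ### Duality of games -/

/-- `ℛ` reflects `𝒜`: every set that picks a point from each member of `ℛ` belongs to `𝒜`, and the
members of `𝒜` meet those of `ℛ`. -/
structure Reflects (ℛ 𝒜 : Set (Set M)) : Prop where
  nonempty : ℛ.Nonempty
  range_mem : ∀ f : ℛ → M, (∀ R : ℛ, f R ∈ (R : Set M)) → range f ∈ 𝒜
  inter_nonempty : ∀ A ∈ 𝒜, ∀ R ∈ ℛ, (A ∩ R).Nonempty

theorem Reflects.exists_range_mem {ℛ 𝒜 : Set (Set M)} (h : Reflects ℛ 𝒜)
    (hne : ∀ R ∈ ℛ, R.Nonempty) : 𝒜.Nonempty := by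
  choose f hf using fun R : ℛ => hne R R.2
  exact ⟨_, h.range_mem f hf⟩

/-- If `f` picks a point of each member of `𝒜`, then some member of `ℛ` consists of picked
points only: otherwise the points missed in the members of `ℛ` would form a member of `𝒜` from which
`f` picks nothing. -/
theorem Reflects.exists_subset_range {ℛ 𝒜 : Set (Set M)} (h : Reflects ℛ 𝒜)
    (f : 𝒜 → M) (hf : ∀ A : 𝒜, f A ∈ (A : Set M)) : ∃ R : ℛ, ∀ x ∈ (R : Set M), ∃ A, f A = x := by
  by_contra! hcon
  choose g hg hg' using hcon
  obtain ⟨R, hR⟩ := hf ⟨_, h.range_mem g hg⟩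
  exact hg' R _ hR.symm

/-- One's strategies in a game correspond to Two's strategies in the game played on a reflecting
family with the complementary target, and conversely. -/
theorem Reflects.dual {G H : SelectionGame M} (h : Reflects H.moves G.moves)
    (hG : G.moves.Nonempty) (ht : ∀ s, s ∈ H.target ↔ s ∉ G.target) : G.Dual H := by
  have pick : ∀ (A : G.moves) (R : H.moves), ∃ x, x ∈ (A : Set M) ∧ x ∈ (R : Set M) :=
    fun A R => h.inter_nonempty A A.2 R R.2
  choose p hpA hpR using pick
  have := hG.to_subtype
  have := h.nonempty.to_subtype
  refine ⟨⟨fun hO => ?_, fun hT => ?_⟩, ⟨fun hT => ?_, fun hO => ?_⟩, ⟨fun hO => ?_, fun hT => ?_⟩,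
    ⟨fun hT => ?_, fun hO => ?_⟩⟩
  · obtain ⟨σ, hσ⟩ := oneWins_iff.1 hO
    let s : List M → H.moves → M := fun l R => p (σ l) R
    refine (twoWins_iff h.nonempty).2 ⟨fun l R => s (answers s l) R, fun l R => hpR _ _,
      fun R => (ht _).2 (hσ _ fun n => ?_)⟩
    rw [← answers_map_range s R n]
    exact hpA _ _
  · obtain ⟨τ, hτ, hw⟩ := (twoWins_iff h.nonempty).1 hT
    -- One offers all answers of Two's strategy and reads off moves that lead to Two's choices
    let s : List H.moves → M → H.moves := fun l x => Function.invFun (τ l) x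
    refine oneWins_iff.2 ⟨fun l => ⟨range (τ (answers s l)), h.range_mem _ (hτ _)⟩,
      fun x hx => (ht _).1 ?_⟩
    have hr := hw fun n => s (answers s ((List.range n).map x)) (x n)
    simp only [← answers_map_range s x] at hr
    rwa [funext fun n => Function.invFun_eq (hx n)] at hr
  · obtain ⟨τ, hτ, hw⟩ := (twoWins_iff hG).1 hT
    choose ρ hρ using fun l => h.exists_subset_range (τ l) (hτ l)
    let s : List G.moves → M → G.moves := fun l x => Function.invFun (τ l) x
    refine oneWins_iff.2 ⟨fun l => ρ (answers s l), fun x hx => fun hxt => (ht _).1 hxt ?_⟩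
    have hr := hw fun n => s (answers s ((List.range n).map x)) (x n)
    simp only [← answers_map_range s x] at hr
    rwa [funext fun n => Function.invFun_eq (hρ _ _ (hx n))] at hr
  · obtain ⟨σ, hσ⟩ := oneWins_iff.1 hO
    let s : List M → G.moves → M := fun l A => p A (σ l)
    refine (twoWins_iff hG).2 ⟨fun l A => s (answers s l) A, fun l A => hpA _ _,
      fun A => not_not.1 fun hn => hσ _ (fun n => ?_) ((ht _).2 hn)⟩
    rw [← answers_map_range s A n]
    exact hpR _ _
  · obtain ⟨σ, hσ⟩ := hO
    exact twoWinsMark_iff.2 ⟨fun n R => p (σ n) R, fun n R => hpR _ _,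
      fun R => (ht _).2 (hσ _ fun n => hpA _ _)⟩
  · obtain ⟨τ, hτ, hw⟩ := twoWinsMark_iff.1 hT
    refine ⟨fun n => ⟨range (τ n), h.range_mem _ (hτ n)⟩, fun x hx => (ht _).1 ?_⟩
    choose R hR using hx
    rw [← funext hR]
    exact hw R
  · obtain ⟨τ, hτ, hw⟩ := twoWinsMark_iff.1 hT
    choose ρ hρ using fun n => h.exists_subset_range (τ n) (hτ n)
    refine ⟨ρ, fun x hx hxt => (ht _).1 hxt ?_⟩
    choose A hA using fun n => hρ n _ (hx n)
    rw [← funext hA]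
    exact hw A
  · obtain ⟨σ, hσ⟩ := hO
    exact twoWinsMark_iff.2 ⟨fun n A => p A (σ n), fun n A => hpA _ _,
      fun A => not_not.1 fun hn => hσ _ (fun n => hpR _ _) ((ht _).2 hn)⟩

theorem Equivalent.of_dual {M' N' : Type*} {G : SelectionGame M} {H : SelectionGame N}
    {G' : SelectionGame M'} {H' : SelectionGame N'} (h : G.Equivalent H) (hG : G.Dual G')
    (hH : H.Dual H') : G'.Equivalent H' := by
  obtain ⟨h1, h2, h3, h4⟩ := h
  obtain ⟨g1, g2, g3, g4⟩ := hG
  obtain ⟨k1, k2, k3, k4⟩ := hH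
  exact ⟨g3.symm.trans ((not_iff_not.1 h4).trans k3), g1.symm.trans ((not_iff_not.1 h3).trans k1),
    not_congr (g2.symm.trans (h2.trans k2)), not_congr (g4.symm.trans (h1.trans k4))⟩

end SelectionGame

/-! ### Minimal cusco maps -/

section Cusco

variable {X : Type*} [TopologicalSpace X]

theorem isCusco_const {K : Set ℝ} (hne : K.Nonempty) (hK : IsCompact K) (hc : Convex ℝ K) :
    IsCusco fun _ : X => K :=
  ⟨⟨.const, fun _ => hne, fun _ => hK⟩, fun _ => hc⟩

theorem isMinimalCusco_const (c : ℝ) : IsMinimalCusco fun _ : X => ({c} : Set ℝ) := by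
  refine ⟨isCusco_const (singleton_nonempty c) isCompact_singleton (convex_singleton c),
    fun Ψ hΨ h => h.antisymm ?_⟩
  rintro ⟨x, y⟩ (rfl : y = c)
  obtain ⟨z, hz⟩ := hΨ.nonempty x
  obtain rfl : z = y := @h (x, z) hz
  exact hz

theorem setValuedGraph_subset_iff {X Y : Type*} {Φ Ψ : X → Set Y} :
    setValuedGraph Φ ⊆ setValuedGraph Ψ ↔ ∀ x, Φ x ⊆ Ψ x :=
  ⟨fun h x y hy => @h (x, y) hy, fun h p hp => h p.1 hp⟩

theorem IsMinimalCusco.eq_of_subset {Φ Ψ : X → Set ℝ} (hΦ : IsMinimalCusco Φ) (hΨ : IsCusco Ψ)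
    (h : ∀ x, Ψ x ⊆ Φ x) : Ψ = Φ := by
  have e := hΦ.2 Ψ hΨ (setValuedGraph_subset_iff.2 h)
  exact funext fun x => (h x).antisymm (setValuedGraph_subset_iff.1 e.ge x)

/-- Every cusco map contains a minimal one: by compactness of the values, the intersection of a
chain of cusco maps is again a cusco map. -/
theorem IsCusco.exists_isMinimalCusco {Φ : X → Set ℝ} (hΦ : IsCusco Φ) :
    ∃ Ψ, IsMinimalCusco Ψ ∧ ∀ x, Ψ x ⊆ Φ x := by
  -- Zorn's lemma for the reversed pointwise inclusion
  have key : ∃ Ψ, OrderDual.toDual Φ ≤ Ψ ∧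
      Maximal (· ∈ {Ψ : (X → Set ℝ)ᵒᵈ | IsCusco Ψ.ofDual}) Ψ := by
    refine zorn_le_nonempty₀ _ ?_ _ hΦ
    intro (c : Set (X → Set ℝ)) hc hchain Θ₀ hΘ₀
    have : Nonempty c := ⟨⟨Θ₀, hΘ₀⟩⟩
    have hcus : ∀ Θ : c, IsCusco (Θ : X → Set ℝ) := fun Θ => hc Θ.2
    have hdir : ∀ x, Directed (· ⊇ ·) fun Θ : c => (Θ : X → Set ℝ) x := by
      intro x Θ Θ'
      rcases hchain.total Θ.2 Θ'.2 with h | h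
      · exact ⟨Θ', h x, Subset.rfl⟩
      · exact ⟨Θ, Subset.rfl, h x⟩
    refine ⟨fun x => ⋂ Θ : c, (Θ : X → Set ℝ) x, ⟨⟨?_, fun x => ?_, fun x => ?_⟩, fun x => ?_⟩,
      fun Θ hΘ x => iInter_subset (fun Θ : c => (Θ : X → Set ℝ) x) ⟨Θ, hΘ⟩⟩
    · refine upperHemicontinuous_iff_isOpen_setOf.2 fun V hV => isOpen_iff_mem_nhds.2 fun x hx => ?_
      obtain ⟨Θ, hΘ⟩ := exists_subset_nhds_of_isCompact (hdir x) (fun Θ => (hcus Θ).isCompact x)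
        fun y hy => hV.mem_nhds (hx hy)
      filter_upwards [(upperHemicontinuous_iff_isOpen_setOf.1 (hcus Θ).upper V hV).mem_nhds hΘ]
        with y hy
      exact (iInter_subset _ Θ).trans hy
    · exact IsCompact.nonempty_iInter_of_directed_nonempty_isCompact_isClosed _ (hdir x)
        (fun Θ => (hcus Θ).nonempty x) (fun Θ => (hcus Θ).isCompact x)
        (fun Θ => ((hcus Θ).isCompact x).isClosed)
    · exact ((hcus ⟨Θ₀, hΘ₀⟩).isCompact x).of_isClosed_subset
        (isClosed_iInter fun Θ => ((hcus Θ).isCompact x).isClosed) (iInter_subset _ (⟨Θ₀, hΘ₀⟩ : c))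
    · exact convex_iInter fun Θ => (hcus Θ).convex x
  obtain ⟨Ψ, hle, hmin⟩ := key
  refine ⟨Ψ, ⟨hmin.1, fun Θ hΘ h => h.antisymm ?_⟩, hle⟩
  have h' : ∀ x, Θ x ⊆ Ψ x := setValuedGraph_subset_iff.1 h
  exact setValuedGraph_subset_iff.2 (hmin.2 (y := OrderDual.toDual Θ) hΘ h')

open Classical in
/-- Shrinking a cusco map `Θ` to a smaller cusco map `Ψ` on an open set gives a cusco map. -/
theorem IsCusco.ite {U : Set X} (hU : IsOpen U) {Ψ Θ : X → Set ℝ} (hΨ : IsCusco Ψ)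
    (hΘ : IsCusco Θ) (h : ∀ x ∈ U, Ψ x ⊆ Θ x) : IsCusco fun x => if x ∈ U then Ψ x else Θ x := by
  refine ⟨⟨?_, fun x => ?_, fun x => ?_⟩, fun x => ?_⟩
  · refine upperHemicontinuous_iff_isOpen_setOf.2 fun V hV => isOpen_iff_mem_nhds.2 fun x hx => ?_
    by_cases hxU : x ∈ U
    · have hx' : Ψ x ⊆ V := by simpa [hxU] using hx
      filter_upwards [hU.mem_nhds hxU,
        (upperHemicontinuous_iff_isOpen_setOf.1 hΨ.upper V hV).mem_nhds hx'] with y hy hyV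
      simpa [hy] using hyV
    · have hx' : Θ x ⊆ V := by simpa [hxU] using hx
      filter_upwards [(upperHemicontinuous_iff_isOpen_setOf.1 hΘ.upper V hV).mem_nhds hx']
        with y hyV
      by_cases hy : y ∈ U
      · simpa [hy] using (h y hy).trans hyV
      · simpa [hy] using hyV
  all_goals by_cases hx : x ∈ U <;> simp only [hx, if_true, if_false]
  exacts [hΨ.nonempty x, hΘ.nonempty x, hΨ.isCompact x, hΘ.isCompact x, hΨ.convex x, hΘ.convex x]

/-- A minimal cusco map is minimal on every open set. -/
theorem IsMinimalCusco.eqOn_of_subset {U : Set X} (hU : IsOpen U) {Φ Ψ : X → Set ℝ}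
    (hΦ : IsMinimalCusco Φ) (hΨ : IsCusco Ψ) (h : ∀ x ∈ U, Ψ x ⊆ Φ x) : EqOn Ψ Φ U := by
  classical
  intro x hx
  have e := hΦ.eq_of_subset (hΨ.ite hU hΦ.1 h) fun y => by
    by_cases hy : y ∈ U
    · simpa [hy] using h y hy
    · simp [hy]
  simpa [hx] using congrFun e x

theorem IsCompact.convexHull_insert_of_convex {K : Set ℝ} (hne : K.Nonempty) (hK : IsCompact K)
    (hc : Convex ℝ K) (c : ℝ) : IsCompact (convexHull ℝ (insert c K)) := by
  have e : convexHull ℝ (insert c K) =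
      (fun p : ℝ × ℝ => c + p.1 • (p.2 - c)) '' (Icc 0 1 ×ˢ K) := by
    rw [convexHull_insert hne, hc.convexHull_eq, convexJoin_singleton_left]
    ext z
    simp only [mem_iUnion, segment_eq_image', mem_image, mem_prod, Prod.exists, exists_prop]
    constructor
    · rintro ⟨y, hy, t, ht, rfl⟩
      exact ⟨t, y, ⟨ht, hy⟩, rfl⟩
    · rintro ⟨t, y, ⟨ht, hy⟩, rfl⟩
      exact ⟨y, hy, t, ht, rfl⟩
  rw [e]
  exact (isCompact_Icc.prod hK).image (by fun_prop)

theorem IsCusco.convexHull_insert {Φ : X → Set ℝ} (hΦ : IsCusco Φ) (c : ℝ) :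
    IsCusco fun x => convexHull ℝ (insert c (Φ x)) := by
  have hcpt : ∀ x, IsCompact (convexHull ℝ (insert c (Φ x))) := fun x =>
    (hΦ.isCompact x).convexHull_insert_of_convex (hΦ.nonempty x) (hΦ.convex x) c
  refine ⟨⟨?_, fun x => (insert_nonempty _ _).convexHull, hcpt⟩, fun x => convex_convexHull ℝ _⟩
  refine upperHemicontinuous_iff_isOpen_setOf.2 fun V hV => isOpen_iff_mem_nhds.2 fun x hx => ?_
  obtain ⟨δ, hδ, hδV⟩ := (hcpt x).exists_thickening_subset_open hV hx
  have hsub := (subset_convexHull ℝ (insert c (Φ x))).trans (Metric.self_subset_thickening hδ _)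
  filter_upwards [(upperHemicontinuous_iff_isOpen_setOf.1 hΦ.upper _
    Metric.isOpen_thickening).mem_nhds ((subset_insert _ _).trans hsub)] with y hy
  exact (convexHull_min (insert_subset (hsub (mem_insert _ _)) hy)
    ((convex_convexHull ℝ _).thickening δ)).trans hδV

/-- A minimal cusco map can be kept on an open set `V` and made constant off the closure of `V`;
on the boundary of `V` the values are selected inside the segments joining both prescriptions. -/
theorem IsMinimalCusco.exists_eqOn {Φ : X → Set ℝ} (hΦ : IsMinimalCusco Φ) {V : Set X}
    (hV : IsOpen V) (c : ℝ) :
    ∃ Ψ, IsMinimalCusco Ψ ∧ EqOn Ψ Φ V ∧ ∀ x ∉ closure V, Ψ x = {c} := by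
  classical
  have hΘ := hΦ.1.convexHull_insert c
  have h1 := hΦ.1.ite hV hΘ fun x _ => (subset_insert _ _).trans (subset_convexHull ℝ _)
  have h2 := (isMinimalCusco_const (X := X) c).1.ite (isClosed_closure (s := V)).isOpen_compl h1
    fun x hx => by
      rw [if_neg fun h => hx (subset_closure h), singleton_subset_iff]
      exact subset_convexHull ℝ _ (mem_insert _ _)
  obtain ⟨Ψ, hΨ, hle⟩ := h2.exists_isMinimalCusco
  refine ⟨Ψ, hΨ, hΦ.eqOn_of_subset hV hΨ.1 fun x hx => ?_, fun x hx => ?_⟩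
  · simpa [hx, subset_closure hx] using hle x
  · have h := hle x
    rw [if_pos (mem_compl hx)] at h
    exact (subset_singleton_iff_eq.1 h).resolve_left (hΨ.1.nonempty x).ne_empty

end Cusco

/-! ### Closures in spaces of minimal cusco maps -/

namespace MC

variable {X : Type*} [TopologicalSpace X] [Nonempty X] {𝒜 : Set (Set X)}

theorem mem_closure_iff (h𝒜 : IsIdealOfClosedSets 𝒜) {S : Set (MC X)} {Φ : MC X} :
    Φ ∈ @closure _ (MC.topology 𝒜) S ↔ ∀ A ∈ 𝒜, ∀ ε > 0, ∃ Ψ ∈ S, (Φ, Ψ) ∈ MC.W A ε := by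
  let := MC.uniformSpace 𝒜
  rw [mem_closure_iff_nhds_basis (nhds_basis_uniformity' (MC.hasBasis_uniformity h𝒜))]
  exact ⟨fun h A hA ε hε => h (A, ε) ⟨hA, hε⟩, fun h p hp => h p.1 hp.1 p.2 hp.2⟩

theorem mem_clusterSets_zero_iff (h𝒜 : IsIdealOfClosedSets 𝒜) {S : Set (MC X)} :
    S ∈ clusterSets (MC.topology 𝒜) (MC.zero X) ↔
      ∀ A ∈ 𝒜, ∀ ε > 0, ∃ Ψ ∈ S, ∀ x ∈ A, Ψ.1 x ⊆ Metric.ball 0 ε := by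
  refine (mem_closure_iff h𝒜).trans (forall₂_congr fun A _ => forall₂_congr fun ε _ =>
    exists_congr fun Ψ => and_congr_right fun _ => forall₂_congr fun x _ => ?_)
  change ({0} : Set ℝ) ⊆ _ ∧ Ψ.1 x ⊆ Metric.thickening ε {0} ↔ _
  rw [Metric.thickening_singleton, and_iff_right_iff_imp, singleton_subset_iff]
  intro h
  obtain ⟨y, hy⟩ := Ψ.2.1.nonempty x
  exact Metric.mem_thickening_iff.2 ⟨y, hy, Metric.mem_ball'.1 (h hy)⟩

theorem exists_mem_pointNhds_zero (h𝒜 : IsIdealOfClosedSets 𝒜) :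
    (pointNhds (MC.topology 𝒜) (MC.zero X)).Nonempty := by
  let := MC.topology 𝒜
  let one : MC X := ⟨fun _ => {1}, isMinimalCusco_const 1⟩
  have h0 : MC.zero X ∈ (closure {one})ᶜ := fun h => by
    obtain ⟨x⟩ := ‹Nonempty X›
    obtain ⟨_, rfl, hΨ⟩ := (mem_clusterSets_zero_iff h𝒜).1 h {x} (h𝒜.singleton x) 1 one_pos
    simpa using hΨ x rfl (mem_singleton (1 : ℝ))
  exact ⟨(closure {one})ᶜ, ⟨isClosed_closure.isOpen_compl, ⟨_, h0⟩, fun h =>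
    (h ▸ mem_univ one : one ∈ (closure {one})ᶜ) (subset_closure rfl)⟩, h0⟩

end MC

/-! ### Reflecting families -/

section Reflection

theorem pointNhds_subset_properOpens {Y : Type*} (t : TopologicalSpace Y) (y : Y) :
    pointNhds t y ⊆ properOpens t := fun _ h => h.1

theorem denseSets_subset_clusterSets {Y : Type*} (t : TopologicalSpace Y) (y : Y) :
    denseSets t ⊆ clusterSets t y := fun _ h => h y

theorem reflects_pointNhds {Y : Type*} (t : TopologicalSpace Y) {y : Y}
    (hne : (pointNhds t y).Nonempty) :
    SelectionGame.Reflects (pointNhds t y) (clusterSets t y) where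
  nonempty := hne
  range_mem f hf := by
    obtain ⟨O, ⟨hO, -, hOne⟩, hyO⟩ := hne
    refine mem_closure_iff.2 fun N hN hyN => ?_
    -- intersecting with a proper neighbourhood makes every neighbourhood proper
    let R : pointNhds t y := ⟨N ∩ O, ⟨hN.inter hO, ⟨y, hyN, hyO⟩,
      fun h => hOne (eq_univ_of_univ_subset (h ▸ inter_subset_right))⟩, hyN, hyO⟩
    exact ⟨f R, (hf R).1, R, rfl⟩
  inter_nonempty A hA R hR := by
    rw [inter_comm]
    exact mem_closure_iff.1 hA R hR.1.1 hR.2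

theorem reflects_properOpens {Y : Type*} (t : TopologicalSpace Y)
    (hne : (properOpens t).Nonempty) :
    SelectionGame.Reflects (properOpens t) (denseSets t) where
  nonempty := hne
  range_mem f hf := by
    refine dense_iff_inter_open.2 fun U hU hUne => ?_
    by_cases h : U = univ
    · obtain ⟨O, hO⟩ := hne
      exact h ▸ ⟨f ⟨O, hO⟩, mem_univ _, ⟨O, hO⟩, rfl⟩
    · exact ⟨f ⟨U, hU, hUne, h⟩, hf ⟨U, hU, hUne, h⟩, ⟨U, hU, hUne, h⟩, rfl⟩
  inter_nonempty A hA R hR := by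
    rw [inter_comm]
    exact dense_iff_inter_open.1 hA R hR.1 hR.2.1

variable {X : Type*} [tX : TopologicalSpace X] {𝒜 : Set (Set X)}

theorem mem_idealCovers_of_subset_properOpens (h𝒜 : IsIdealOfClosedSets 𝒜) {𝒰 : Set (Set X)}
    (h𝒰 : 𝒰 ⊆ properOpens tX) (hcov : ∀ A ∈ 𝒜, ∃ U ∈ 𝒰, A ⊆ U) : 𝒰 ∈ idealCovers tX 𝒜 := by
  refine ⟨fun U hU => (h𝒰 hU).1, eq_univ_of_forall fun x => ?_, fun h => (h𝒰 h).2.1.ne_empty rfl,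
    fun h => (h𝒰 h).2.2 rfl, hcov⟩
  obtain ⟨U, hU, hx⟩ := hcov {x} (h𝒜.singleton x)
  exact ⟨U, hU, hx rfl⟩

theorem mem_properOpens_of_mem_idealCovers {𝒰 : Set (Set X)} (h𝒰 : 𝒰 ∈ idealCovers tX 𝒜)
    {U : Set X} (hU : U ∈ 𝒰) : U ∈ properOpens tX :=
  ⟨h𝒰.1 U hU, nonempty_iff_ne_empty.2 fun h => h𝒰.2.2.1 (h ▸ hU),
    fun h => h𝒰.2.2.2.1 (h ▸ hU)⟩

theorem reflects_setNhdsFamily [Nonempty X] (h𝒜 : IsIdealOfClosedSets 𝒜) :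
    SelectionGame.Reflects (setNhdsFamily tX 𝒜) (idealCovers tX 𝒜) where
  nonempty := ⟨_, mem_image_of_mem _ (h𝒜.singleton (Classical.arbitrary X))⟩
  range_mem f hf := by
    refine mem_idealCovers_of_subset_properOpens h𝒜 ?_ fun A hA =>
      ⟨_, mem_range_self ⟨_, mem_image_of_mem _ hA⟩, (hf ⟨_, mem_image_of_mem _ hA⟩).2⟩
    rintro _ ⟨⟨_, A, hA, rfl⟩, rfl⟩
    exact (hf ⟨_, A, hA, rfl⟩).1
  inter_nonempty := by
    rintro 𝒰 h𝒰 _ ⟨A, hA, rfl⟩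
    obtain ⟨U, hU, hAU⟩ := h𝒰.2.2.2.2 A hA
    exact ⟨U, hU, mem_properOpens_of_mem_idealCovers h𝒰 hU, hAU⟩

theorem idealCovers_nonempty [T1Space X] [Nonempty X] (h𝒜 : IsIdealOfClosedSets 𝒜) :
    (idealCovers tX 𝒜).Nonempty := by
  refine (reflects_setNhdsFamily h𝒜).exists_range_mem ?_
  rintro _ ⟨A, hA, rfl⟩
  obtain ⟨p, hp⟩ := (ne_univ_iff_exists_notMem A).1 fun h => h𝒜.proper (h ▸ hA)
  have hAp : A ⊆ {p}ᶜ := fun x hx hxp => hp (hxp ▸ hx)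
  exact ⟨{p}ᶜ, ⟨isOpen_compl_singleton, (h𝒜.nonempty A hA).mono hAp,
    fun h => (h ▸ mem_univ p : p ∈ ({p}ᶜ : Set X)) rfl⟩, hAp⟩

/-- In an enumerated cover, each member of the ideal is contained in infinitely many terms: it may
be enlarged by points outside of the first `N` terms. -/
theorem exists_ge_subset_of_range_mem_idealCovers (h𝒜 : IsIdealOfClosedSets 𝒜) {U : ℕ → Set X}
    (hU : range U ∈ idealCovers tX 𝒜) (N : ℕ) : ∀ A ∈ 𝒜, ∃ n ≥ N, A ⊆ U n := by
  induction N with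
  | zero =>
    intro A hA
    obtain ⟨_, ⟨n, rfl⟩, h⟩ := hU.2.2.2.2 A hA
    exact ⟨n, n.zero_le, h⟩
  | succ N ih =>
    intro A hA
    obtain ⟨p, hp⟩ := (ne_univ_iff_exists_notMem (U N)).1 fun h => hU.2.2.2.1 ⟨N, h⟩
    obtain ⟨n, hn, h⟩ := ih _ (h𝒜.union A hA {p} (h𝒜.singleton p))
    refine ⟨n, hn.lt_of_ne fun e => hp ?_, subset_union_left.trans h⟩
    exact e ▸ h (Or.inr rfl)

end Reflection

/-! ### Covers of `X` and sets of minimal cusco maps -/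

section Translation

variable {X : Type*} [tX : TopologicalSpace X] [Nonempty X] {𝒜 ℬ : Set (Set X)}

/-- A set clustering at zero yields a cover on each member of which one of its maps is small. The
sets `{x | Φ x ⊆ (-ε, ε)}` form such a cover unless one of them is all of `X`, in which
case any cover will do. -/
theorem exists_idealCover_of_mem_clusterSets [T1Space X] (h𝒜 : IsIdealOfClosedSets 𝒜)
    {S : Set (MC X)} (hS : S ∈ clusterSets (MC.topology 𝒜) (MC.zero X)) {ε : ℝ} (hε : 0 < ε) :
    ∃ 𝒰 ∈ idealCovers tX 𝒜, ∀ U ∈ 𝒰, ∃ Φ ∈ S, ∀ x ∈ U, Φ.1 x ⊆ Metric.ball 0 ε := by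
  by_cases h : ∃ Φ ∈ S, ∀ x, Φ.1 x ⊆ Metric.ball 0 ε
  · obtain ⟨𝒰, h𝒰⟩ := idealCovers_nonempty h𝒜
    obtain ⟨Φ, hΦ, hsmall⟩ := h
    exact ⟨𝒰, h𝒰, fun U _ => ⟨Φ, hΦ, fun x _ => hsmall x⟩⟩
  · push Not at h
    refine ⟨{U | U.Nonempty ∧ ∃ Φ ∈ S, {x | Φ.1 x ⊆ Metric.ball 0 ε} = U},
      mem_idealCovers_of_subset_properOpens h𝒜 ?_ fun A hA => ?_, ?_⟩
    · rintro _ ⟨hne, Φ, hΦ, rfl⟩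
      refine ⟨upperHemicontinuous_iff_isOpen_setOf.1 Φ.2.1.upper _ Metric.isOpen_ball, hne,
        fun hu => ?_⟩
      obtain ⟨x, hx⟩ := h Φ hΦ
      exact hx (hu.ge (mem_univ x))
    · obtain ⟨Φ, hΦ, hsmall⟩ := (MC.mem_clusterSets_zero_iff h𝒜).1 hS A hA ε hε
      exact ⟨_, ⟨(h𝒜.nonempty A hA).mono hsmall, Φ, hΦ, rfl⟩, hsmall⟩
    · rintro _ ⟨-, Φ, hΦ, rfl⟩
      exact ⟨Φ, hΦ, fun x hx => hx⟩

/-- The maps that are constantly `1` off some member of an `𝒜`-cover are dense: by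
`𝒜`-normality, a given map can be kept near a given `A ∈ 𝒜` and replaced by `1` elsewhere. -/
theorem dense_setOf_eq_one_off_cover (h𝒜 : IsIdealOfClosedSets 𝒜) (hnormal : IsIdealNormal 𝒜)
    {𝒰 : Set (Set X)} (h𝒰 : 𝒰 ∈ idealCovers tX 𝒜) :
    {Φ : MC X | ∃ U ∈ 𝒰, ∀ x ∉ U, Φ.1 x = {1}} ∈ denseSets (MC.topology 𝒜) := by
  refine fun Φ => (MC.mem_closure_iff h𝒜).2 fun A hA ε hε => ?_
  obtain ⟨U, hU, hAU⟩ := h𝒰.2.2.2.2 A hA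
  obtain ⟨V, hV, hAV, -, hVU⟩ := hnormal A hA U (h𝒰.1 U hU) hAU
  obtain ⟨Ψ, hΨ, heq, hone⟩ := Φ.2.exists_eqOn hV 1
  refine ⟨⟨Ψ, hΨ⟩, ⟨U, hU, fun x hx => hone x fun h => hx (hVU h)⟩, fun x hx => ?_⟩
  change Φ.1 x ⊆ Metric.thickening ε (Ψ x) ∧ Ψ x ⊆ Metric.thickening ε (Φ.1 x)
  rw [heq (hAV hx)]
  exact ⟨Metric.self_subset_thickening hε _, Metric.self_subset_thickening hε _⟩

theorem transfers_idealCovers_clusterSets [T1Space X] (h𝒜 : IsIdealOfClosedSets 𝒜)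
    (hℬ : IsIdealOfClosedSets ℬ) :
    (G₁ (idealCovers tX 𝒜) (idealCovers tX ℬ)).Transfers
      (G₁ (clusterSets (MC.topology 𝒜) (MC.zero X))
        (clusterSets (MC.topology ℬ) (MC.zero X))) := by
  have : Nonempty (MC X) := ⟨MC.zero X⟩
  choose I hI hIJ using fun (n : ℕ) (S : clusterSets (MC.topology 𝒜) (MC.zero X)) =>
    exists_idealCover_of_mem_clusterSets h𝒜 S.2 (Nat.one_div_pos_of_nat (α := ℝ) (n := n))
  choose! J hJ hsmall using hIJ
  refine SelectionGame.transfers_of_translation (idealCovers_nonempty h𝒜)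
    ⟨_, denseSets_subset_clusterSets _ _ (@dense_univ _ (MC.topology 𝒜))⟩
    (fun n S => ⟨I n S, hI n S⟩) J hJ fun S U hU hUℬ => ?_
  refine (MC.mem_clusterSets_zero_iff hℬ).2 fun B hB ε hε => ?_
  obtain ⟨N, hN⟩ := exists_nat_one_div_lt hε
  -- the index is taken so large that the bound used in round `n` is below `ε`
  obtain ⟨n, hn, hBU⟩ := exists_ge_subset_of_range_mem_idealCovers hℬ hUℬ N B hB
  exact ⟨_, mem_range_self n, fun x hx => (hsmall n (S n) (U n) (hU n) x (hBU hx)).trans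
    (Metric.ball_subset_ball ((Nat.one_div_le_one_div hn).trans hN.le))⟩

theorem transfers_denseSets_idealCovers [T1Space X] (h𝒜 : IsIdealOfClosedSets 𝒜)
    (hℬ : IsIdealOfClosedSets ℬ) (hnormal : IsIdealNormal 𝒜) :
    (G₁ (denseSets (MC.topology 𝒜)) (clusterSets (MC.topology ℬ) (MC.zero X))).Transfers
      (G₁ (idealCovers tX 𝒜) (idealCovers tX ℬ)) := by
  -- membership in the dense set attached to `𝒰`, in the form from which `choose!` makes `J`
  have hJ : ∀ (𝒰 : idealCovers tX 𝒜) (Φ : MC X), (∃ U ∈ 𝒰.1, ∀ x ∉ U, Φ.1 x = {1}) →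
      ∃ U ∈ 𝒰.1, ∀ x ∉ U, Φ.1 x = {1} := fun _ _ h => h
  choose! J hJ hone using hJ
  refine SelectionGame.transfers_of_translation (H := G₁ (idealCovers tX 𝒜) (idealCovers tX ℬ))
    ⟨_, @dense_univ _ (MC.topology 𝒜)⟩ (idealCovers_nonempty h𝒜)
    (fun _ 𝒰 => ⟨_, dense_setOf_eq_one_off_cover h𝒜 hnormal 𝒰.2⟩) (fun _ 𝒰 Φ => J 𝒰 Φ)
    (fun _ => hJ) fun 𝒰 Φ hΦ hcl => ?_
  refine mem_idealCovers_of_subset_properOpens hℬ ?_ fun B hB => ?_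
  · rintro _ ⟨n, rfl⟩
    exact mem_properOpens_of_mem_idealCovers (𝒰 n).2 (hJ _ _ (hΦ n))
  · obtain ⟨_, ⟨n, rfl⟩, hsmall⟩ := (MC.mem_clusterSets_zero_iff hℬ).1 hcl B hB 1 one_pos
    refine ⟨_, mem_range_self n, fun x hx => by_contra fun hxU => ?_⟩
    have h := hsmall x hx
    rw [hone _ _ (hΦ n) x hxU] at h
    simpa using h (mem_singleton (1 : ℝ))

end Translation

/-! ### Equivalence and duality of the games -/

theorem mainTheorem2 {X : Type*} [tX : TopologicalSpace X] [T2Space X] [Nonempty X]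
    (𝒜 ℬ : Set (Set X)) (h𝒜 : IsIdealOfClosedSets 𝒜) (hℬ : IsIdealOfClosedSets ℬ)
    (hnormal : IsIdealNormal 𝒜) :
    ((G₁ (idealCovers tX 𝒜) (idealCovers tX ℬ)).Equivalent
        (G₁ (clusterSets (MC.topology 𝒜) (MC.zero X)) (clusterSets (MC.topology ℬ) (MC.zero X))) ∧
      (G₁ (clusterSets (MC.topology 𝒜) (MC.zero X))
          (clusterSets (MC.topology ℬ) (MC.zero X))).Equivalent
        (G₁ (denseSets (MC.topology 𝒜)) (clusterSets (MC.topology ℬ) (MC.zero X)))) ∧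
    ((G₁ (setNhdsFamily tX 𝒜) (idealCovers tX ℬ)ᶜ).Equivalent
        (G₁ (pointNhds (MC.topology 𝒜) (MC.zero X)) (clusterSets (MC.topology ℬ) (MC.zero X))ᶜ) ∧
      (G₁ (pointNhds (MC.topology 𝒜) (MC.zero X))
          (clusterSets (MC.topology ℬ) (MC.zero X))ᶜ).Equivalent
        (G₁ (properOpens (MC.topology 𝒜)) (clusterSets (MC.topology ℬ) (MC.zero X))ᶜ)) ∧
    (G₁ (idealCovers tX 𝒜) (idealCovers tX ℬ)).Dual
      (G₁ (setNhdsFamily tX 𝒜) (idealCovers tX ℬ)ᶜ) := by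
  have hdense : (denseSets (MC.topology 𝒜)).Nonempty := ⟨_, @dense_univ _ (MC.topology 𝒜)⟩
  have hsub := denseSets_subset_clusterSets (MC.topology 𝒜) (MC.zero X)
  have h12 := transfers_idealCovers_clusterSets h𝒜 hℬ
  have h23 := SelectionGame.transfers_of_moves_subset
    (ℬ := clusterSets (MC.topology ℬ) (MC.zero X)) hdense hsub
  have h31 := transfers_denseSets_idealCovers h𝒜 hℬ hnormal
  have e12 := h12.equivalent (h23.trans h31)
  have e23 := h23.equivalent (h31.trans h12)
  have hpoint := MC.exists_mem_pointNhds_zero h𝒜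
  have d1 : (G₁ (idealCovers tX 𝒜) (idealCovers tX ℬ)).Dual
      (G₁ (setNhdsFamily tX 𝒜) (idealCovers tX ℬ)ᶜ) :=
    SelectionGame.Reflects.dual (reflects_setNhdsFamily h𝒜) (idealCovers_nonempty h𝒜)
      fun _ => Iff.rfl
  have d2 : (G₁ (clusterSets (MC.topology 𝒜) (MC.zero X))
      (clusterSets (MC.topology ℬ) (MC.zero X))).Dual
      (G₁ (pointNhds (MC.topology 𝒜) (MC.zero X))
        (clusterSets (MC.topology ℬ) (MC.zero X))ᶜ) :=
    SelectionGame.Reflects.dual (reflects_pointNhds _ hpoint) (hdense.mono hsub) fun _ => Iff.rfl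
  have d3 : (G₁ (denseSets (MC.topology 𝒜)) (clusterSets (MC.topology ℬ) (MC.zero X))).Dual
      (G₁ (properOpens (MC.topology 𝒜)) (clusterSets (MC.topology ℬ) (MC.zero X))ᶜ) :=
    SelectionGame.Reflects.dual
      (reflects_properOpens _ (hpoint.mono (pointNhds_subset_properOpens _ _))) hdense
      fun _ => Iff.rfl
  exact ⟨⟨e12, e23⟩, ⟨e12.of_dual d1 d2, e23.of_dual d2 d3⟩, d1⟩
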